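/- Let $(V,Y,\mathbf 1,\omega)$ be a vertex operator algebra over $\mathbb C$ and let $g$ be an automorphism of $V$ of finite order $T$; put $V^r=\{v\in V: gv=e^{2\pi i r/T}v\}$ for $0\le r\le T-1$. A weak $g$-twisted $V$-module is a complex vector space $M$ with a linear map $v\mapsto Y_M(v,z)=\sum_{n\in\mathbb Q}v_nz^{-n-1}$ ($v_n\in\operatorname{End}M$) such that, for all $0\le r\le T-1$, $u\in V^r$, $v\in V$ and $w\in M$: $u_n=0$ unless $n\in\frac rT+\mathbb Z$; $v_lw=0$ for $l\gg0$; $Y_M(\mathbf 1,z)=1$; and the twisted Jacobi identity holds: $$z_0^{-1}\delta\Big(\frac{z_1-z_2}{z_0}\Big)Y_M(u,z_1)Y_M(v,z_2)-z_0^{-1}\delta\Big(\frac{z_2-z_1}{-z_0}\Big)Y_M(v,z_2)Y_M(u,z_1)=z_2^{-1}\Big(\frac{z_1-z_0}{z_2}\Big)^{-r/T}\delta\Big(\frac{z_1-z_0}{z_2}\Big)Y_M(Y(u,z_0)v,z_2).$$ A $g$-twisted $V$-module is a weak $g$-twisted $V$-module $M$ which is the direct sum of the eigenspaces $M_\lambda$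 ($\lambda\in\mathbb C$) of $L(0)=\omega_1$, where every $M_\lambda$ is finite-dimensional and, for each fixed $\lambda$, $M_{\lambda+n/T}=0$ for all sufficiently small integers $n$. It is simple if it is nonzero and $0$ and $M$ are its only subspaces stable under all $v_n$ (submodules). Two such modules are equivalent if there is a linear bijection between them commuting with all $v_n$. **Proposition.** Suppose that there are only finitely many simple $g$-twisted $V$-modules up to equivalence. Then every $g$-twisted $V$-module $M$ has a finite composition series $0=M^0\subseteq M^1\subseteq\cdots\subseteq M^k=M$ of submodules such that each factor $M^{i+1}/M^i$ is a simple $g$-twisted $V$-module. -/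

import Mathlib

universe u v

noncomputable section

open scoped VertexOperator

/-- A vertex operator algebra structure on the complex vector space `V`, in the usual sense of
Frenkel, Lepowsky and Meurman. A vertex operator `Y u` is a field `Y(u, z) = ∑ u_n z^(-n-1)`, and
`(Y u)[[n]]` is its mode `u_n`; the truncation condition `u_n w = 0` for `n ≫ 0` is part of
Mathlib's type `VertexOperator` (Laurent series in `z` after applying the field to a vector). -/
structure VertexOperatorAlgebra (V : Type u) [AddCommGroup V] [Module ℂ V] where
  /-- The state-field correspondence `u ↦ Y(u, z)`. -/
  Y : V →ₗ[ℂ] VertexOperator ℂ V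
  /-- The vacuum vector. -/
  vac : V
  /-- The Virasoro (conformal) vector. -/
  ω : V
  /-- The rank (central charge). -/
  rank : ℂ
  /-- The homogeneous subspaces `V_n`. -/
  gr : ℤ → Submodule ℂ V
  gr_isInternal : DirectSum.IsInternal gr
  gr_finite : ∀ n, FiniteDimensional ℂ (gr n)
  gr_bounded : ∃ N : ℤ, ∀ n < N, gr n = ⊥
  vac_mem : vac ∈ gr 0
  ω_mem : ω ∈ gr 2
  /-- `Y(1, z) = 1`. -/
  vacuum : ∀ (n : ℤ) (w : V), ((Y vac)[[n]]) w = if n = -1 then w else 0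
  /-- `Y(v, z) 1` has no negative powers of `z`, and its constant term is `v`. -/
  creation : ∀ v : V, (∀ n : ℤ, 0 ≤ n → ((Y v)[[n]]) vac = 0) ∧ ((Y v)[[-1]]) vac = v
  /-- The Jacobi identity, applied to a vector `w`: the coefficient of
  `z₀^(-l-1) z₁^(-m-1) z₂^(-n-1)`. All sums are finite by truncation. -/
  jacobi : ∀ (u v w : V) (l m n : ℤ),
    (∑ᶠ i : ℕ, ((-1 : ℂ) ^ i * (Ring.choose l i : ℤ)) •
        ((Y u)[[m + l - i]]) (((Y v)[[n + i]]) w)) -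
      (∑ᶠ i : ℕ, ((-1 : ℂ) ^ (l + i) * (Ring.choose l i : ℤ)) •
        ((Y v)[[n + l - i]]) (((Y u)[[m + i]]) w)) =
    ∑ᶠ i : ℕ, ((Ring.choose m i : ℤ) : ℂ) • ((Y (((Y u)[[l + i]]) v))[[m + n - i]]) w
  /-- The Virasoro relations for `L(n) = ω_(n+1)`. -/
  virasoro : ∀ (m n : ℤ) (w : V),
    ((Y ω)[[m + 1]]) (((Y ω)[[n + 1]]) w) - ((Y ω)[[n + 1]]) (((Y ω)[[m + 1]]) w) =
      ((m : ℂ) - n) • ((Y ω)[[m + n + 1]]) w +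
        (if m + n = 0 then ((m : ℂ) ^ 3 - m) / 12 * rank else 0) • w
  /-- `L(0)` acts on `V_n` as multiplication by `n`. -/
  L_zero : ∀ (n : ℤ), ∀ w ∈ gr n, ((Y ω)[[1]]) w = (n : ℂ) • w
  /-- `Y(L(-1)v, z) = d/dz Y(v, z)`. -/
  L_neg_one : ∀ (v : V) (n : ℤ) (w : V),
    ((Y (((Y ω)[[0]]) v))[[n]]) w = (-(n : ℂ)) • ((Y v)[[n - 1]]) w

section Operators

variable {V : Type u} [AddCommGroup V] [Module ℂ V]
variable {M : Type v} [AddCommGroup M] [Module ℂ M]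

/-- The space `V^r = {v | g v = exp(2πir/T) v}`, where `T` is the order of `g`. -/
def twistEigenspace (g : V ≃ₗ[ℂ] V) (r : ℕ) : Submodule ℂ V :=
  Module.End.eigenspace (g : V →ₗ[ℂ] V)
    (Complex.exp (2 * Real.pi * Complex.I * r / orderOf g))

/-- The subspace `W` of `M` is stable under all operators `v_n`. Here and below, a linear map
`v ↦ Y_M(v, z) = ∑ v_n z^(-n-1)` with `n` ranging over `ℚ` is given by `YM v n = v_n`. -/
def IsStableUnder (YM : V →ₗ[ℂ] (ℚ → Module.End ℂ M)) (W : Submodule ℂ M) : Prop :=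
  ∀ (v : V) (n : ℚ), ∀ w ∈ W, YM v n w ∈ W

/-- The operators `v_n` restricted to a stable subspace. -/
def restrictOperators (YM : V →ₗ[ℂ] (ℚ → Module.End ℂ M)) (W : Submodule ℂ M)
    (hW : IsStableUnder YM W) : V →ₗ[ℂ] (ℚ → Module.End ℂ W) where
  toFun v n := (YM v n).restrict (hW v n)
  map_add' a b := by
    ext n w
    simp
  map_smul' c a := by
    ext n w
    simp

/-- The operators `v_n` induced on the quotient by a stable subspace. -/
def quotientOperators (YM : V →ₗ[ℂ] (ℚ → Module.End ℂ M)) (W : Submodule ℂ M)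
    (hW : IsStableUnder YM W) : V →ₗ[ℂ] (ℚ → Module.End ℂ (M ⧸ W)) where
  toFun v n := W.mapQ W (YM v n) (hW v n)
  map_add' a b := by
    ext n w
    simp
  map_smul' c a := by
    ext n w
    simp

theorem IsStableUnder.submoduleOf {YM : V →ₗ[ℂ] (ℚ → Module.End ℂ M)} {P Q : Submodule ℂ M}
    (hP : IsStableUnder YM P) (hQ : IsStableUnder YM Q) :
    IsStableUnder (restrictOperators YM Q hQ) (P.submoduleOf Q) :=
  fun v n w hw => hP v n w hw

/-- The operators `v_n` induced on the factor `Q / (P ∩ Q)` of two stable subspaces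
(which is `Q / P` when `P ≤ Q`). -/
def factorOperators (YM : V →ₗ[ℂ] (ℚ → Module.End ℂ M)) (P Q : Submodule ℂ M)
    (hP : IsStableUnder YM P) (hQ : IsStableUnder YM Q) :
    V →ₗ[ℂ] (ℚ → Module.End ℂ (Q ⧸ P.submoduleOf Q)) :=
  quotientOperators (restrictOperators YM Q hQ) (P.submoduleOf Q) (hP.submoduleOf hQ)

end Operators

namespace VertexOperatorAlgebra

variable {V : Type u} [AddCommGroup V] [Module ℂ V]

/-- `g` is an automorphism of the vertex operator algebra: `g Y(u, z) g⁻¹ = Y(gu, z)`, and `g`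
fixes the vacuum and the Virasoro vector. -/
structure IsAutomorphism (A : VertexOperatorAlgebra V) (g : V ≃ₗ[ℂ] V) : Prop where
  map_vac : g A.vac = A.vac
  map_ω : g A.ω = A.ω
  map_mode : ∀ (u : V) (n : ℤ) (w : V), g (((A.Y u)[[n]]) w) = ((A.Y (g u))[[n]]) (g w)

section Modules

variable {M : Type v} [AddCommGroup M] [Module ℂ M]

/-- `(M, YM)` is a weak `g`-twisted `V`-module; `T` is the order of `g`. -/
structure IsWeakTwistedModule (A : VertexOperatorAlgebra V) (g : V ≃ₗ[ℂ] V)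
    (YM : V →ₗ[ℂ] (ℚ → Module.End ℂ M)) : Prop where
  /-- For `u ∈ V^r`, only the exponents `n ∈ r/T + ℤ` occur. -/
  mode_eq_zero : ∀ r < orderOf g, ∀ u ∈ twistEigenspace g r, ∀ n : ℚ,
    (∀ k : ℤ, n ≠ (r : ℚ) / orderOf g + k) → YM u n = 0
  /-- `v_l w = 0` for `l ≫ 0`. -/
  truncation : ∀ (v : V) (w : M), ∃ N : ℚ, ∀ l : ℚ, N ≤ l → YM v l w = 0
  /-- `Y_M(1, z) = 1`. -/
  vacuum : ∀ n : ℚ, YM A.vac n = if n = -1 then 1 else 0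
  /-- The twisted Jacobi identity for `u ∈ V^r`, applied to a vector `w`: the coefficient of
  `z₀^(-l-1) z₁^(-m-1) z₂^(-n-1)`, where `l ∈ ℤ`, `m ∈ r/T + ℤ`, `n ∈ ℚ` (both sides of the
  identity have no other powers of `z₀` and `z₁`). The coefficient on the right arises from
  `z₂⁻¹ ((z₁ - z₀)/z₂)^(-r/T) δ((z₁ - z₀)/z₂)`, since
  `(-1)^i * choose (i - m - 1) i = choose m i`. All sums are finite by truncation. -/
  jacobi : ∀ r < orderOf g, ∀ u ∈ twistEigenspace g r, ∀ (v : V) (w : M) (l : ℤ) (m n : ℚ),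
    (∃ k : ℤ, m = (r : ℚ) / orderOf g + k) →
    (∑ᶠ i : ℕ, ((-1 : ℂ) ^ i * (Ring.choose l i : ℤ)) •
        YM u (m + l - i) (YM v (n + i) w)) -
      (∑ᶠ i : ℕ, ((-1 : ℂ) ^ (l + i) * (Ring.choose l i : ℤ)) •
        YM v (n + l - i) (YM u (m + i) w)) =
    ∑ᶠ i : ℕ, ((Ring.choose m i : ℚ) : ℂ) • YM (((A.Y u)[[l + i]]) v) (m + n - i) w

/-- The space `M_a` of vectors of weight `a`: the `a`-eigenspace of `L(0) = ω_1` on `M`. -/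
def weightSpace (A : VertexOperatorAlgebra V) (YM : V →ₗ[ℂ] (ℚ → Module.End ℂ M)) (a : ℂ) :
    Submodule ℂ M :=
  Module.End.eigenspace (YM A.ω 1) a

/-- `(M, YM)` is a (an ordinary) `g`-twisted `V`-module: a weak one, graded by the eigenspaces of
`L(0)`, which are finite-dimensional, and with `M_(n/T + a) = 0` for all small enough
integers `n`, for each fixed `a`. -/
structure IsTwistedModule (A : VertexOperatorAlgebra V) (g : V ≃ₗ[ℂ] V)
    (YM : V →ₗ[ℂ] (ℚ → Module.End ℂ M)) : Prop extends A.IsWeakTwistedModule g YM where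
  isInternal : DirectSum.IsInternal (A.weightSpace YM)
  finite_weightSpace : ∀ a : ℂ, FiniteDimensional ℂ (A.weightSpace YM a)
  bounded_below : ∀ a : ℂ, ∃ N : ℤ, ∀ n < N, A.weightSpace YM ((n : ℂ) / orderOf g + a) = ⊥

/-- `(M, YM)` is a simple `g`-twisted `V`-module: it is nonzero, and `0` and `M` are its only
submodules. -/
structure IsSimpleTwistedModule (A : VertexOperatorAlgebra V) (g : V ≃ₗ[ℂ] V)
    (YM : V →ₗ[ℂ] (ℚ → Module.End ℂ M)) : Prop extends A.IsTwistedModule g YM where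
  nontrivial : Nontrivial M
  eq_bot_or_eq_top : ∀ W : Submodule ℂ M, IsStableUnder YM W → W = ⊥ ∨ W = ⊤

/-- `M` has a finite composition series `0 = F_0 ⊆ F_1 ⊆ ⋯ ⊆ F_n = M` of submodules, each
factor `F_(i+1) / F_i` of which is a simple `g`-twisted `V`-module. -/
def HasFiniteCompositionSeries (A : VertexOperatorAlgebra V) (g : V ≃ₗ[ℂ] V)
    (YM : V →ₗ[ℂ] (ℚ → Module.End ℂ M)) : Prop :=
  ∃ (n : ℕ) (F : Fin (n + 1) → Submodule ℂ M) (hF : ∀ i, IsStableUnder YM (F i)),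
    F 0 = ⊥ ∧ F (Fin.last n) = ⊤ ∧
      ∀ i : Fin n, F i.castSucc ≤ F i.succ ∧
        A.IsSimpleTwistedModule g
          (factorOperators YM (F i.castSucc) (F i.succ) (hF i.castSucc) (hF i.succ))

end Modules

/-- A simple `g`-twisted `V`-module, with its underlying space. -/
structure SimpleTwistedModule (A : VertexOperatorAlgebra V) (g : V ≃ₗ[ℂ] V) where
  /-- The underlying vector space. -/
  carrier : Type v
  [addCommGroup : AddCommGroup carrier]
  [module : Module ℂ carrier]
  /-- The vertex operators. -/
  YM : V →ₗ[ℂ] (ℚ → Module.End ℂ carrier)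
  isSimple : A.IsSimpleTwistedModule g YM

attribute [instance] SimpleTwistedModule.addCommGroup SimpleTwistedModule.module

/-- Equivalence (isomorphism) of modules: a linear bijection `f` with
`f Y_M(u, z) = Y_W(u, z) f` for all `u ∈ V`. -/
def SimpleTwistedModule.Equivalent {A : VertexOperatorAlgebra V} {g : V ≃ₗ[ℂ] V}
    (M W : SimpleTwistedModule.{u, v} A g) : Prop :=
  ∃ f : M.carrier ≃ₗ[ℂ] W.carrier,
    ∀ (a : V) (n : ℚ) (w : M.carrier), f (M.YM a n w) = W.YM a n (f w)

/-- There are only finitely many simple `g`-twisted `V`-modules up to equivalence. -/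
def FinitelyManySimpleTwistedModules (A : VertexOperatorAlgebra V) (g : V ≃ₗ[ℂ] V) : Prop :=
  ∃ (k : ℕ) (W : Fin k → SimpleTwistedModule.{u, v} A g),
    ∀ N : SimpleTwistedModule.{u, v} A g, ∃ i, N.Equivalent (W i)

end VertexOperatorAlgebra

end

/-!
A covering pair `P ⋖ Q` of submodules of a twisted module `M` has a simple factor `Q / P`, which
carries, by hypothesis, a nonzero vector whose weight lies in a fixed finite set `Λ`. Since `L(0)`
is diagonalizable, this vector lifts to a vector of the same weight in `Q` but not in `P`. Hence
the finite-dimensional space `U = ⨁_{a ∈ Λ} M_a` distinguishes the two submodules of every covering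
pair. Every strict inclusion `P < Q` contains a covering pair, because cyclic submodules have
maximal submodules, so `W ↦ W ∩ U` is strictly monotone and `M` has finite length as a module over
the algebra generated by the modes. If there are finitely many simple twisted modules, then `Λ` is
obtained by choosing a weight of each of them.
-/

open scoped VertexOperator

section FiniteLength

theorem exists_covBy_of_not_le {α : Type*} [CompleteLattice α] [IsCompactlyGenerated α] {a b : α}
    (h : ¬ b ≤ a) : ∃ c d, c ⋖ d ∧ d ≤ b ∧ d ⊓ a ≤ c := by
  obtain ⟨d, hd, hdb, hda⟩ : ∃ d, IsCompactElement d ∧ d ≤ b ∧ ¬ d ≤ a := by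
    contrapose! h
    exact le_iff_compact_le_imp.2 h
  have := CompleteLattice.Iic_coatomic_of_compact_element hd
  obtain htop | ⟨c, hc, hle⟩ := eq_top_or_exists_le_coatom (⟨d ⊓ a, inf_le_left⟩ : Set.Iic d)
  · exact absurd (inf_eq_left.1 (congrArg Subtype.val htop)) hda
  · exact ⟨c, d, Set.Iic.isCoatom_iff.1 hc, hdb, hle⟩

variable {K R M : Type*} [Ring K] [Ring R] [AddCommGroup M] [Module K M] [Module R M]
  [SMul K R] [IsScalarTower K R M]

theorem strictMono_comap_subtype_of_covBy (U : Submodule K M)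
    (hU : ∀ P Q : Submodule R M, P ⋖ Q → ∃ x ∈ U, x ∈ Q ∧ x ∉ P) :
    StrictMono fun W : Submodule R M => (W.restrictScalars K).comap U.subtype := by
  intro P Q hPQ
  obtain ⟨C, D, hCD, hDQ, hDP⟩ := exists_covBy_of_not_le hPQ.not_ge
  obtain ⟨x, hxU, hxD, hxC⟩ := hU C D hCD
  refine SetLike.lt_iff_le_and_exists.2 ⟨fun _ hy => hPQ.le hy, ⟨x, hxU⟩, hDQ hxD, fun hxP => ?_⟩
  exact hxC (hDP ⟨hxD, hxP⟩)

theorem isFiniteLength_of_covBy (U : Submodule K M) [IsNoetherian K U] [IsArtinian K U]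
    (hU : ∀ P Q : Submodule R M, P ⋖ Q → ∃ x ∈ U, x ∈ Q ∧ x ∉ P) : IsFiniteLength R M := by
  have hmono := strictMono_comap_subtype_of_covBy U hU
  exact isFiniteLength_iff_isNoetherian_isArtinian.2
    ⟨isNoetherian_iff'.2 hmono.wellFoundedGT, hmono.wellFoundedLT⟩

end FiniteLength

section Eigenspaces

open Module.End

variable {K M N : Type*} [CommRing K] [AddCommGroup M] [Module K M] [AddCommGroup N] [Module K N]
  {a : Module.End K M} {b : Module.End K N} {f : M →ₗ[K] N}

theorem map_eigenspace_le (hf : ∀ x, f (a x) = b (f x)) (μ : K) :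
    (a.eigenspace μ).map f ≤ b.eigenspace μ := by
  rintro _ ⟨x, hx, rfl⟩
  rw [mem_eigenspace_iff, ← hf, mem_eigenspace_iff.1 hx, map_smul]

theorem eigenspace_eq_comap_of_injective (hf : ∀ x, f (a x) = b (f x))
    (hinj : Function.Injective f) (μ : K) : a.eigenspace μ = (b.eigenspace μ).comap f := by
  ext x
  rw [Submodule.mem_comap, mem_eigenspace_iff, mem_eigenspace_iff, ← hf, ← map_smul, hinj.eq_iff]

theorem iSup_map_eigenspace_eq_top (hsurj : Function.Surjective f) (ha : ⨆ μ, a.eigenspace μ = ⊤) :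
    ⨆ μ, (a.eigenspace μ).map f = ⊤ := by
  rw [← Submodule.map_iSup, ha, Submodule.map_top, LinearMap.range_eq_top.2 hsurj]

theorem eigenspace_eq_map_of_surjective [IsDomain K] [Module.IsTorsionFree K N]
    (hf : ∀ x, f (a x) = b (f x)) (hsurj : Function.Surjective f) (ha : ⨆ μ, a.eigenspace μ = ⊤)
    (μ : K) :
    b.eigenspace μ = (a.eigenspace μ).map f :=
  congrFun ((b.eigenspaces_iSupIndep.le_iff_eq_of_iSup_eq_top
    (iSup_map_eigenspace_eq_top hsurj ha)).1 (map_eigenspace_le hf)).symm μ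

theorem iSup_eigenspace_eq_top_of_surjective [IsDomain K] [Module.IsTorsionFree K N]
    (hf : ∀ x, f (a x) = b (f x)) (hsurj : Function.Surjective f) (ha : ⨆ μ, a.eigenspace μ = ⊤) :
    ⨆ μ, b.eigenspace μ = ⊤ := by
  simp only [eigenspace_eq_map_of_surjective hf hsurj ha, iSup_map_eigenspace_eq_top hsurj ha]

end Eigenspaces

section StableSubspaces

open Module.End

variable {K M N : Type*} [Field K] [AddCommGroup M] [Module K M] [AddCommGroup N] [Module K N]
  {a : Module.End K M} {b : Module.End K N} {f : M →ₗ[K] N}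

theorem mem_of_sum_eigenvectors_mem {W : Submodule K M} (hW : W ≤ W.comap a) {s : Finset K}
    {m : K → M} (hm : ∀ μ ∈ s, m μ ∈ a.eigenspace μ) (hsum : ∑ μ ∈ s, m μ ∈ W) :
    ∀ μ ∈ s, m μ ∈ W := by
  -- Modulo `W`, the `m μ` are eigenvectors for distinct eigenvalues with sum zero.
  have hindep := eigenspaces_iSupIndep (W.mapQ W a hW)
  have hquot : ∀ μ ∈ s, W.mkQ (m μ) ∈ eigenspace (W.mapQ W a hW) μ := fun μ hμ =>
    map_eigenspace_le (f := W.mkQ) (fun _ => rfl) μ (Submodule.mem_map_of_mem (hm μ hμ))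
  have hzero : ∑ μ ∈ s, W.mkQ (m μ) = 0 := by
    rwa [← map_sum, ← LinearMap.mem_ker, W.ker_mkQ]
  intro μ hμ
  rw [← W.ker_mkQ, LinearMap.mem_ker]
  exact (iSupIndep_iff_finsetSum_eq_zero_imp_eq_zero _).1 hindep s _ hquot hzero μ hμ

theorem iSup_inf_eigenspace_eq {W : Submodule K M} (hW : W ≤ W.comap a)
    (ha : ⨆ μ, a.eigenspace μ = ⊤) : ⨆ μ, W ⊓ a.eigenspace μ = W := by
  refine le_antisymm (iSup_le fun _ => inf_le_left) fun x hx => ?_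
  obtain ⟨m, hm, rfl⟩ := (Submodule.mem_iSup_iff_exists_finsupp _ x).1 (ha ▸ Submodule.mem_top)
  exact Submodule.sum_mem _ fun μ hμ => Submodule.mem_iSup_of_mem μ
    ⟨mem_of_sum_eigenvectors_mem hW (fun ν _ => hm ν) hx μ hμ, hm μ⟩

theorem iSup_eigenspace_eq_top_of_injective (hf : ∀ x, f (a x) = b (f x))
    (hinj : Function.Injective f) (hb : ⨆ μ, b.eigenspace μ = ⊤) :
    ⨆ μ, a.eigenspace μ = ⊤ := by
  have hrange : LinearMap.range f ≤ (LinearMap.range f).comap b := by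
    rintro _ ⟨x, rfl⟩
    exact ⟨a x, hf x⟩
  refine Submodule.map_injective_of_injective hinj ?_
  simp only [Submodule.map_iSup, eigenspace_eq_comap_of_injective hf hinj,
    Submodule.map_comap_eq, iSup_inf_eigenspace_eq hrange hb, Submodule.map_top]

end StableSubspaces

section Intertwiners

variable {V M N : Type*} [AddCommGroup V] [Module ℂ V] [AddCommGroup M] [Module ℂ M]
  [AddCommGroup N] [Module ℂ N]

/-- The linear map `f` is an intertwiner (homomorphism of modules): `f Y_M(v, z) = Y_N(v, z) f` for
all `v ∈ V`. -/
def Intertwines (YM : V →ₗ[ℂ] (ℚ → Module.End ℂ M)) (YN : V →ₗ[ℂ] (ℚ → Module.End ℂ N))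
    (f : M →ₗ[ℂ] N) : Prop :=
  ∀ (v : V) (n : ℚ) (w : M), f (YM v n w) = YN v n (f w)

variable {YM : V →ₗ[ℂ] (ℚ → Module.End ℂ M)} {YN : V →ₗ[ℂ] (ℚ → Module.End ℂ N)}

theorem intertwines_subtype {Q : Submodule ℂ M} (hQ : IsStableUnder YM Q) :
    Intertwines (restrictOperators YM Q hQ) YM Q.subtype :=
  fun _ _ _ => rfl

theorem intertwines_mkQ {P : Submodule ℂ M} (hP : IsStableUnder YM P) :
    Intertwines YM (quotientOperators YM P hP) P.mkQ :=
  fun _ _ _ => rfl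

theorem IsStableUnder.comap {f : M →ₗ[ℂ] N} (hf : Intertwines YM YN f) {W : Submodule ℂ N}
    (hW : IsStableUnder YN W) : IsStableUnder YM (W.comap f) := by
  intro v n w hw
  rw [Submodule.mem_comap, hf]
  exact hW v n _ hw

theorem IsStableUnder.map {f : M →ₗ[ℂ] N} (hf : Intertwines YM YN f) {W : Submodule ℂ M}
    (hW : IsStableUnder YM W) : IsStableUnder YN (W.map f) := by
  rintro v n _ ⟨w, hw, rfl⟩
  exact ⟨YM v n w, hW v n w hw, hf v n w⟩

end Intertwiners

section ModeAlgebra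

variable {V M : Type*} [AddCommGroup V] [Module ℂ V] [AddCommGroup M] [Module ℂ M]

/-- The algebra of operators on `M` generated by the modes `v_n`. Its submodules of `M` are the
subspaces stable under all `v_n`, so that the theory of modules of finite length over a ring
applies to them. -/
def modeAlgebra (YM : V →ₗ[ℂ] (ℚ → Module.End ℂ M)) : Subalgebra ℂ (Module.End ℂ M) :=
  Algebra.adjoin ℂ {a | ∃ v n, YM v n = a}

variable {YM : V →ₗ[ℂ] (ℚ → Module.End ℂ M)}

theorem isStableUnder_restrictScalars (P : Submodule (modeAlgebra YM) M) :
    IsStableUnder YM (P.restrictScalars ℂ) :=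
  fun v n _ hw => P.smul_mem ⟨YM v n, Algebra.subset_adjoin ⟨v, n, rfl⟩⟩ hw

theorem IsStableUnder.mem_of_mem_modeAlgebra {W : Submodule ℂ M} (hW : IsStableUnder YM W)
    {a : Module.End ℂ M} (ha : a ∈ modeAlgebra YM) : ∀ w ∈ W, a w ∈ W := by
  induction ha using Algebra.adjoin_induction with
  | mem _ h =>
    obtain ⟨v, n, rfl⟩ := h
    exact hW v n
  | algebraMap c => exact fun w hw => W.smul_mem c hw
  | add _ _ _ _ ha hb => exact fun w hw => W.add_mem (ha w hw) (hb w hw)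
  | mul _ _ _ _ ha hb => exact fun w hw => ha _ (hb w hw)

theorem IsStableUnder.exists_restrictScalars_eq {W : Submodule ℂ M} (hW : IsStableUnder YM W) :
    ∃ P : Submodule (modeAlgebra YM) M, P.restrictScalars ℂ = W :=
  ⟨{ W with smul_mem' := fun a w hw => hW.mem_of_mem_modeAlgebra a.2 w hw }, rfl⟩

end ModeAlgebra

namespace VertexOperatorAlgebra

section JacobiIdentity

variable {V M N : Type*} [AddCommGroup V] [Module ℂ V] [AddCommGroup M] [Module ℂ M]
  [AddCommGroup N] [Module ℂ N]
  {YM : V →ₗ[ℂ] (ℚ → Module.End ℂ M)} {YN : V →ₗ[ℂ] (ℚ → Module.End ℂ N)}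

/-- The coefficient of `z₀^(-l-1) z₁^(-m-1) z₂^(-n-1)` in the left-hand side of the twisted Jacobi
identity for `u` and `v`, applied to `w`. -/
noncomputable def jacobiCommutator (YM : V →ₗ[ℂ] (ℚ → Module.End ℂ M)) (u v : V) (l : ℤ)
    (m n : ℚ) (w : M) : M :=
  (∑ᶠ i : ℕ, ((-1 : ℂ) ^ i * (Ring.choose l i : ℤ)) • YM u (m + l - i) (YM v (n + i) w)) -
    ∑ᶠ i : ℕ, ((-1 : ℂ) ^ (l + i) * (Ring.choose l i : ℤ)) • YM v (n + l - i) (YM u (m + i) w)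

/-- The coefficient of `z₀^(-l-1) z₁^(-m-1) z₂^(-n-1)` in the right-hand side of the twisted Jacobi
identity for `u` and `v`, applied to `w`. -/
noncomputable def jacobiIterate (A : VertexOperatorAlgebra V)
    (YM : V →ₗ[ℂ] (ℚ → Module.End ℂ M)) (u v : V) (l : ℤ) (m n : ℚ) (w : M) : M :=
  ∑ᶠ i : ℕ, ((Ring.choose m i : ℚ) : ℂ) • YM (((A.Y u)[[l + i]]) v) (m + n - i) w

open Filter

theorem hasFiniteSupport_of_eventually_eq_zero {E : Type*} [Zero E] {F : ℕ → E}
    (h : ∀ᶠ i in atTop, F i = 0) : F.HasFiniteSupport := by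
  rwa [← Nat.cofinite_eq_atTop, eventually_cofinite] at h

theorem eventually_mode_add_eq_zero {v : V} {w : M} (h : ∃ B : ℚ, ∀ l, B ≤ l → YM v l w = 0)
    (n : ℚ) : ∀ᶠ i : ℕ in atTop, YM v (n + i) w = 0 :=
  (tendsto_atTop_add_const_left _ n tendsto_natCast_atTop_atTop).eventually (eventually_atTop.2 h)

theorem eventually_ncoeff_add_eq_zero (Y : VertexOperator ℂ V) (l : ℤ) (v : V) :
    ∀ᶠ i : ℕ in atTop, (Y[[l + i]]) v = 0 := by
  have hlim : Tendsto (fun i : ℕ => l + (i : ℤ)) atTop atTop :=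
    tendsto_atTop_add_const_left _ l tendsto_natCast_atTop_atTop
  filter_upwards [hlim.eventually_gt_atTop (-((HahnModule.of ℂ).symm (Y v)).order - 1)] with i hi
  exact Y.ncoeff_eq_zero_of_lt_order _ v (by lia)

theorem map_jacobiCommutator {f : M →ₗ[ℂ] N} (hf : Intertwines YM YN f)
    (htrunc : ∀ (v : V) (w : M), ∃ B : ℚ, ∀ l, B ≤ l → YM v l w = 0)
    (u v : V) (l : ℤ) (m n : ℚ) (w : M) :
    f (jacobiCommutator YM u v l m n w) = jacobiCommutator YN u v l m n (f w) := by
  have hv := eventually_mode_add_eq_zero (htrunc v w) n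
  have hu := eventually_mode_add_eq_zero (htrunc u w) m
  rw [jacobiCommutator, map_sub, map_finsum f, map_finsum f]
  · simp only [map_smul, hf _ _ _, jacobiCommutator]
  · exact hasFiniteSupport_of_eventually_eq_zero <| hu.mono fun i hi => by simp [hi]
  · exact hasFiniteSupport_of_eventually_eq_zero <| hv.mono fun i hi => by simp [hi]

theorem map_jacobiIterate (A : VertexOperatorAlgebra V) {f : M →ₗ[ℂ] N}
    (hf : Intertwines YM YN f) (u v : V) (l : ℤ) (m n : ℚ) (w : M) :
    f (A.jacobiIterate YM u v l m n w) = A.jacobiIterate YN u v l m n (f w) := by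
  rw [jacobiIterate, map_finsum f]
  · simp only [map_smul, hf _ _ _, jacobiIterate]
  · exact hasFiniteSupport_of_eventually_eq_zero <|
      (eventually_ncoeff_add_eq_zero (A.Y u) l v).mono fun i hi => by simp [hi]

end JacobiIdentity

section Transfer

variable {V M N : Type*} [AddCommGroup V] [Module ℂ V] [AddCommGroup M] [Module ℂ M]
  [AddCommGroup N] [Module ℂ N] {A : VertexOperatorAlgebra V} {g : V ≃ₗ[ℂ] V}
  {YM : V →ₗ[ℂ] (ℚ → Module.End ℂ M)} {YN : V →ₗ[ℂ] (ℚ → Module.End ℂ N)} {f : M →ₗ[ℂ] N}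

theorem IsWeakTwistedModule.of_surjective (hM : A.IsWeakTwistedModule g YM)
    (hf : Intertwines YM YN f) (hsurj : Function.Surjective f) : A.IsWeakTwistedModule g YN where
  mode_eq_zero r hr u hu n hn := by
    ext y
    obtain ⟨w, rfl⟩ := hsurj y
    rw [← hf, hM.mode_eq_zero r hr u hu n hn, LinearMap.zero_apply, map_zero, LinearMap.zero_apply]
  truncation v y := by
    obtain ⟨w, rfl⟩ := hsurj y
    obtain ⟨B, hB⟩ := hM.truncation v w
    exact ⟨B, fun l hl => by rw [← hf, hB l hl, map_zero]⟩
  vacuum n := by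
    ext y
    obtain ⟨w, rfl⟩ := hsurj y
    rw [← hf, hM.vacuum]
    split_ifs <;> simp
  jacobi r hr u hu v y l m n hm := by
    obtain ⟨w, rfl⟩ := hsurj y
    calc jacobiCommutator YN u v l m n (f w)
        = f (jacobiCommutator YM u v l m n w) :=
          (map_jacobiCommutator hf hM.truncation u v l m n w).symm
      _ = f (A.jacobiIterate YM u v l m n w) := congrArg f (hM.jacobi r hr u hu v w l m n hm)
      _ = A.jacobiIterate YN u v l m n (f w) := map_jacobiIterate A hf u v l m n w

theorem IsWeakTwistedModule.of_injective (hN : A.IsWeakTwistedModule g YN)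
    (hf : Intertwines YM YN f) (hinj : Function.Injective f) : A.IsWeakTwistedModule g YM := by
  have htrunc : ∀ (v : V) (w : M), ∃ B : ℚ, ∀ l, B ≤ l → YM v l w = 0 := fun v w => by
    obtain ⟨B, hB⟩ := hN.truncation v (f w)
    exact ⟨B, fun l hl => hinj (by rw [hf, hB l hl, map_zero])⟩
  refine ⟨fun r hr u hu n hn => ?_, htrunc, fun n => ?_, fun r hr u hu v w l m n hm => hinj ?_⟩
  · ext w
    refine hinj ?_
    rw [hf, hN.mode_eq_zero r hr u hu n hn, LinearMap.zero_apply, LinearMap.zero_apply, map_zero]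
  · ext w
    refine hinj ?_
    rw [hf, hN.vacuum]
    split_ifs <;> simp
  · calc f (jacobiCommutator YM u v l m n w)
        = jacobiCommutator YN u v l m n (f w) := map_jacobiCommutator hf htrunc u v l m n w
      _ = A.jacobiIterate YN u v l m n (f w) := hN.jacobi r hr u hu v (f w) l m n hm
      _ = f (A.jacobiIterate YM u v l m n w) := (map_jacobiIterate A hf u v l m n w).symm

theorem isInternal_weightSpace (h : ⨆ a, A.weightSpace YM a = ⊤) :
    DirectSum.IsInternal (A.weightSpace YM) :=
  DirectSum.isInternal_submodule_of_iSupIndep_of_iSup_eq_top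
    (YM A.ω 1).eigenspaces_iSupIndep h

theorem IsTwistedModule.iSup_weightSpace (hM : A.IsTwistedModule g YM) :
    ⨆ a, A.weightSpace YM a = ⊤ :=
  hM.isInternal.submodule_iSup_eq_top

theorem map_weightSpace_le (hf : Intertwines YM YN f) (a : ℂ) :
    (A.weightSpace YM a).map f ≤ A.weightSpace YN a :=
  map_eigenspace_le (hf A.ω 1) a

theorem weightSpace_eq_comap_of_injective (hf : Intertwines YM YN f)
    (hinj : Function.Injective f) (a : ℂ) :
    A.weightSpace YM a = (A.weightSpace YN a).comap f :=
  eigenspace_eq_comap_of_injective (hf A.ω 1) hinj a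

theorem IsTwistedModule.weightSpace_eq_map_of_surjective (hM : A.IsTwistedModule g YM)
    (hf : Intertwines YM YN f) (hsurj : Function.Surjective f) (a : ℂ) :
    A.weightSpace YN a = (A.weightSpace YM a).map f :=
  eigenspace_eq_map_of_surjective (hf A.ω 1) hsurj hM.iSup_weightSpace a

theorem IsTwistedModule.of_surjective (hM : A.IsTwistedModule g YM) (hf : Intertwines YM YN f)
    (hsurj : Function.Surjective f) : A.IsTwistedModule g YN where
  toIsWeakTwistedModule := hM.toIsWeakTwistedModule.of_surjective hf hsurj
  isInternal := isInternal_weightSpace <|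
    iSup_eigenspace_eq_top_of_surjective (hf A.ω 1) hsurj hM.iSup_weightSpace
  finite_weightSpace a := by
    have := hM.finite_weightSpace a
    rw [hM.weightSpace_eq_map_of_surjective hf hsurj]
    infer_instance
  bounded_below a := by
    obtain ⟨B, hB⟩ := hM.bounded_below a
    refine ⟨B, fun n hn => ?_⟩
    rw [hM.weightSpace_eq_map_of_surjective hf hsurj, hB n hn, Submodule.map_bot]

theorem IsTwistedModule.of_injective (hN : A.IsTwistedModule g YN) (hf : Intertwines YM YN f)
    (hinj : Function.Injective f) : A.IsTwistedModule g YM where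
  toIsWeakTwistedModule := hN.toIsWeakTwistedModule.of_injective hf hinj
  isInternal := isInternal_weightSpace <|
    iSup_eigenspace_eq_top_of_injective (hf A.ω 1) hinj hN.iSup_weightSpace
  finite_weightSpace a := by
    have := hN.finite_weightSpace a
    rw [weightSpace_eq_comap_of_injective hf hinj]
    exact Module.Finite.of_injective (f.submoduleComap _) fun _ _ h =>
      Subtype.ext (hinj (congrArg Subtype.val h))
  bounded_below a := by
    obtain ⟨B, hB⟩ := hN.bounded_below a
    refine ⟨B, fun n hn => ?_⟩
    rw [weightSpace_eq_comap_of_injective hf hinj, hB n hn, Submodule.comap_bot,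
      LinearMap.ker_eq_bot.2 hinj]

end Transfer

section Factors

variable {V M : Type*} [AddCommGroup V] [Module ℂ V] [AddCommGroup M] [Module ℂ M]
  {A : VertexOperatorAlgebra V} {g : V ≃ₗ[ℂ] V} {YM : V →ₗ[ℂ] (ℚ → Module.End ℂ M)}

theorem IsTwistedModule.restrict (hM : A.IsTwistedModule g YM) {Q : Submodule ℂ M}
    (hQ : IsStableUnder YM Q) : A.IsTwistedModule g (restrictOperators YM Q hQ) :=
  hM.of_injective (intertwines_subtype hQ) Q.injective_subtype

theorem IsTwistedModule.factor (hM : A.IsTwistedModule g YM) {P Q : Submodule ℂ M}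
    (hP : IsStableUnder YM P) (hQ : IsStableUnder YM Q) :
    A.IsTwistedModule g (factorOperators YM P Q hP hQ) :=
  (hM.restrict hQ).of_surjective (intertwines_mkQ _) (Submodule.mkQ_surjective _)

theorem IsTwistedModule.exists_mem_weightSpace_notMem (hM : A.IsTwistedModule g YM)
    {P Q : Submodule ℂ M} (hP : IsStableUnder YM P) (hQ : IsStableUnder YM Q) {a : ℂ}
    (ha : A.weightSpace (factorOperators YM P Q hP hQ) a ≠ ⊥) :
    ∃ x ∈ A.weightSpace YM a, x ∈ Q ∧ x ∉ P := by
  obtain ⟨y, hy, hy0⟩ := Submodule.exists_mem_ne_zero_of_ne_bot ha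
  obtain ⟨x, hx, rfl⟩ := ((hM.restrict hQ).weightSpace_eq_map_of_surjective (intertwines_mkQ _)
    (Submodule.mkQ_surjective _) a).le hy
  exact ⟨x, map_weightSpace_le (intertwines_subtype hQ) a ⟨x, hx, rfl⟩, x.2,
    fun hxP => hy0 ((Submodule.Quotient.mk_eq_zero _).2 hxP)⟩

theorem eq_bot_or_eq_top_of_covBy {P Q : Submodule (modeAlgebra YM) M} (hPQ : P ⋖ Q)
    {W : Submodule ℂ (Q.restrictScalars ℂ ⧸
      (P.restrictScalars ℂ).submoduleOf (Q.restrictScalars ℂ))}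
    (hW : IsStableUnder (factorOperators YM _ _ (isStableUnder_restrictScalars P)
      (isStableUnder_restrictScalars Q)) W) : W = ⊥ ∨ W = ⊤ := by
  obtain ⟨X, hX⟩ := ((hW.comap (intertwines_mkQ _)).map
    (intertwines_subtype (isStableUnder_restrictScalars Q))).exists_restrictScalars_eq
  have hXcomap : (X.restrictScalars ℂ).submoduleOf (Q.restrictScalars ℂ) =
      W.comap (Submodule.mkQ _) := by
    rw [hX]
    exact Submodule.comap_map_eq_of_injective (Submodule.injective_subtype _) _
  have hWX : W = ((X.restrictScalars ℂ).submoduleOf (Q.restrictScalars ℂ)).map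
      (Submodule.mkQ _) := by
    rw [hXcomap, Submodule.map_comap_eq_of_surjective (Submodule.mkQ_surjective _)]
  have hPX : P ≤ X := fun x hx =>
    hXcomap.ge (Submodule.le_comap_mkQ _ W (x := ⟨x, hPQ.le hx⟩) hx)
  have hXQ : X ≤ Q := fun x hx => Submodule.map_subtype_le (Q.restrictScalars ℂ) _ (hX.le hx)
  rcases hPQ.eq_or_eq hPX hXQ with rfl | rfl
  · exact Or.inl (hWX.trans (Submodule.mkQ_map_self _))
  · refine Or.inr (hWX.trans ?_)
    rw [Submodule.submoduleOf_self, Submodule.map_top, Submodule.range_mkQ]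

theorem IsTwistedModule.isSimple_factor (hM : A.IsTwistedModule g YM)
    {P Q : Submodule (modeAlgebra YM) M} (hPQ : P ⋖ Q) :
    A.IsSimpleTwistedModule g (factorOperators YM _ _ (isStableUnder_restrictScalars P)
      (isStableUnder_restrictScalars Q)) where
  toIsTwistedModule := hM.factor _ _
  nontrivial := by
    rw [Submodule.Quotient.nontrivial_iff, Ne, Submodule.submoduleOf_eq_top]
    exact hPQ.lt.not_ge
  eq_bot_or_eq_top _ hW := eq_bot_or_eq_top_of_covBy hPQ hW

theorem IsTwistedModule.hasFiniteCompositionSeries (hM : A.IsTwistedModule g YM)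
    (hlen : IsFiniteLength (modeAlgebra YM) M) : A.HasFiniteCompositionSeries g YM := by
  obtain ⟨s, hbot, htop⟩ := isFiniteLength_iff_exists_compositionSeries.1 hlen
  exact ⟨s.length, fun i => (s i).restrictScalars ℂ, fun i => isStableUnder_restrictScalars (s i),
    congrArg (Submodule.restrictScalars ℂ) hbot, congrArg (Submodule.restrictScalars ℂ) htop,
    fun i => ⟨(s.step i).le, hM.isSimple_factor (s.step i)⟩⟩

end Factors

section FinitelyManySimple

variable {V : Type u} [AddCommGroup V] [Module ℂ V] {A : VertexOperatorAlgebra V} {g : V ≃ₗ[ℂ] V}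

theorem IsTwistedModule.exists_weightSpace_ne_bot {M : Type*} [AddCommGroup M] [Module ℂ M]
    [Nontrivial M] {YM : V →ₗ[ℂ] (ℚ → Module.End ℂ M)} (hM : A.IsTwistedModule g YM) :
    ∃ a, A.weightSpace YM a ≠ ⊥ := by
  by_contra! h
  exact bot_ne_top (α := Submodule ℂ M) (by rw [← hM.iSup_weightSpace, iSup_eq_bot.2 h])

theorem SimpleTwistedModule.Equivalent.weightSpace_ne_bot {S N : SimpleTwistedModule A g}
    (h : S.Equivalent N) {a : ℂ} (ha : A.weightSpace N.YM a ≠ ⊥) :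
    A.weightSpace S.YM a ≠ ⊥ := by
  obtain ⟨f, hf⟩ := h
  have hmap : A.weightSpace N.YM a = (A.weightSpace S.YM a).map (f : S.carrier →ₗ[ℂ] N.carrier) :=
    S.isSimple.weightSpace_eq_map_of_surjective hf f.surjective a
  contrapose ha
  rw [hmap, ha, Submodule.map_bot]

theorem exists_finset_weightSpace_ne_bot
    (h : FinitelyManySimpleTwistedModules.{u, v} A g) :
    ∃ Λ : Finset ℂ, ∀ S : SimpleTwistedModule.{u, v} A g, ∃ a ∈ Λ, A.weightSpace S.YM a ≠ ⊥ := by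
  obtain ⟨k, S, hS⟩ := h
  have hweight : ∀ i, ∃ a, A.weightSpace (S i).YM a ≠ ⊥ := fun i =>
    have := (S i).isSimple.nontrivial
    (S i).isSimple.exists_weightSpace_ne_bot
  choose c hc using hweight
  refine ⟨Finset.univ.image c, fun N => ?_⟩
  obtain ⟨i, hi⟩ := hS N
  exact ⟨c i, Finset.mem_image_of_mem c (Finset.mem_univ i), hi.weightSpace_ne_bot (hc i)⟩

end FinitelyManySimple

end VertexOperatorAlgebra

theorem proposition9_general {V : Type u} [AddCommGroup V] [Module ℂ V]
    (A : VertexOperatorAlgebra V) (g : V ≃ₗ[ℂ] V) (hT : IsOfFinOrder g)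
    (hΛ : ∃ Λ : Finset ℂ, ∀ S : VertexOperatorAlgebra.SimpleTwistedModule.{u, v} A g,
      ∃ a ∈ Λ, A.weightSpace S.YM a ≠ ⊥)
    {M : Type v} [AddCommGroup M] [Module ℂ M] (YM : V →ₗ[ℂ] (ℚ → Module.End ℂ M))
    (hM : A.IsTwistedModule g YM) :
    A.HasFiniteCompositionSeries g YM := by
  obtain ⟨Λ, hΛ⟩ := hΛ
  have := hM.finite_weightSpace
  refine hM.hasFiniteCompositionSeries <|
    isFiniteLength_of_covBy (Λ.sup (A.weightSpace YM)) fun P Q hPQ => ?_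
  obtain ⟨a, haΛ, ha⟩ := hΛ ⟨_, _, hM.isSimple_factor hPQ⟩
  obtain ⟨x, hxa, hxQ, hxP⟩ := hM.exists_mem_weightSpace_notMem
    (isStableUnder_restrictScalars P) (isStableUnder_restrictScalars Q) ha
  exact ⟨x, Finset.le_sup (f := A.weightSpace YM) haΛ hxa, hxQ, hxP⟩

theorem proposition9 {V : Type u} [AddCommGroup V] [Module ℂ V]
    (A : VertexOperatorAlgebra V) (g : V ≃ₗ[ℂ] V) (hg : A.IsAutomorphism g)
    (hT : IsOfFinOrder g)
    (hfin : VertexOperatorAlgebra.FinitelyManySimpleTwistedModules.{u, v} A g)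
    {M : Type v} [AddCommGroup M] [Module ℂ M] (YM : V →ₗ[ℂ] (ℚ → Module.End ℂ M))
    (hM : A.IsTwistedModule g YM) :
    A.HasFiniteCompositionSeries g YM :=
  proposition9_general A g hT (VertexOperatorAlgebra.exists_finset_weightSpace_ne_bot hfin) YM hM
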